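/- A permutation $\sigma=\sigma_1\cdots\sigma_n$ of $\{1,\dots,n\}$ has size $|\sigma|=n$. It is simple if the only blocks of consecutive positions $\sigma_i\sigma_{i+1}\cdots\sigma_j$ whose set of values is an interval of integers are the singletons and the whole permutation. Write $\pi\preceq\sigma$ if some subsequence $\sigma_{i_1}\cdots\sigma_{i_r}$, $i_1<\dots<i_r$, is order-isomorphic to $\pi$, and $\pi\prec\sigma$ if moreover $\pi\neq\sigma$. Exceptional permutations are the following permutations, for $m\ge 2$: $2\,4\cdots(2m)\,1\,3\cdots(2m-1)$; $(2m-1)(2m-3)\cdots 1\,(2m)(2m-2)\cdots 2$; $(m+1)\,1\,(m+2)\,2\cdots(2m)\,m$; and $m\,(2m)\,(m-1)\,(2m-1)\cdots 1\,(m+1)$. Let $G$ be the directed graph whose vertices are the simple permutations of size at least $4$, with an edge from $\sigma$ to $\pi$ if and only if $\pi\prec\sigma$ and there is no simple permutation $\tau$ with $\pi\prec\tau\prec\sigma$, and let $G_1$ be obtained from $G$ by deleting all edges between two exceptional permutations. For a simple permutation $\pi$ let $$S_{\pi-}=\{\sigma : \sigma \text{ is simple},\ \sigma\preceq\pi,\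 |\sigma|=|\pi|-1\}$$ be its set of children. Let $s_n$ be the number of simple permutations of size $n$ and $S_n^k$ the number of simple permutations $\pi$ of size $n$ with $|S_{\pi-}|=k$. **Proposition.** For every fixed integer $k\ge 0$, $$\lim_{n\to\infty}\frac{S_n^k}{s_n}=0 .$$ Likewise, for every fixed $k\ge 0$, the proportion, among the simple permutations of size $n$, of those whose outdegree in $G_1$ equals $k$ tends to $0$ as $n\to\infty$. -/

import Mathlib

open Filter Topology

namespace SimplePermPoset

/-- A permutation of arbitrary finite size: a size `n` with a bijection of `{0, …, n-1}`
(positions and values are shifted by one with respect to `{1, …, n}`). -/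
abbrev SPerm : Type := Σ n : ℕ, Equiv.Perm (Fin n)

/-- `σ` is simple: each block of consecutive positions whose set of values is an interval is a
singleton or the whole permutation. -/
def IsSimple {n : ℕ} (σ : Equiv.Perm (Fin n)) : Prop :=
  ∀ i j : Fin n, i ≤ j → (σ '' Set.Icc i j).OrdConnected → i = j ∨ Set.Icc i j = Set.univ

/-- `π` is a pattern of `σ`: some subsequence of `σ` is order-isomorphic to `π`. -/
def IsPattern (π σ : SPerm) : Prop :=
  ∃ f : Fin π.1 → Fin σ.1, StrictMono f ∧
    ∀ a b : Fin π.1, π.2 a < π.2 b ↔ σ.2 (f a) < σ.2 (f b)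

/-- `π` is a pattern of `σ` and differs from it. -/
def IsStrictPattern (π σ : SPerm) : Prop := IsPattern π σ ∧ π ≠ σ

/-- The word `σ(1) σ(2) … σ(n)` with values in `{1, …, n}`. -/
def word (σ : SPerm) : List ℕ := List.ofFn fun i : Fin σ.1 => (σ.2 i : ℕ) + 1

/-- Exceptional permutations, of the four types, for `m ≥ 2`:
`2 4 … (2m) 1 3 … (2m-1)`, `(2m-1) (2m-3) … 1 (2m) (2m-2) … 2`,
`(m+1) 1 (m+2) 2 … (2m) m` and `m (2m) (m-1) (2m-1) … 1 (m+1)`. -/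
def IsExceptional (σ : SPerm) : Prop :=
  ∃ m : ℕ, 2 ≤ m ∧
    (word σ = ((List.range m).map fun i => 2 * i + 2) ++ ((List.range m).map fun i => 2 * i + 1) ∨
     word σ = ((List.range m).map fun i => 2 * m - 1 - 2 * i) ++
       ((List.range m).map fun i => 2 * m - 2 * i) ∨
     word σ = (List.range m).flatMap (fun i => [m + 1 + i, i + 1]) ∨
     word σ = (List.range m).flatMap (fun i => [m - i, 2 * m - i]))

/-- The simple permutations of size at least four. -/
abbrev Vertex : Type := {σ : SPerm // 4 ≤ σ.1 ∧ IsSimple σ.2}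

/-- The graph `G` of the poset of simple permutations: an edge goes from `σ` to `π` if `π` is a
strict pattern of `σ` and no simple permutation lies strictly between them. -/
def G : Digraph Vertex where
  Adj σ π := IsStrictPattern π.1 σ.1 ∧
    ¬ ∃ τ : Vertex, IsStrictPattern π.1 τ.1 ∧ IsStrictPattern τ.1 σ.1

/-- `G₁` is `G` without the edges between two exceptional permutations. -/
def G₁ : Digraph Vertex where
  Adj σ π := G.Adj σ π ∧ ¬ (IsExceptional σ.1 ∧ IsExceptional π.1)

/-- The number of edges of `H` that leave the vertex `v`. -/
noncomputable def outdegree {V : Type*} (H : Digraph V) (v : V) : ℕ := {w : V | H.Adj v w}.ncard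

/-- The children of `π`: the simple patterns of `π` of size `|π| - 1`. -/
def children (π : SPerm) : Set SPerm :=
  {σ | IsSimple σ.2 ∧ IsPattern σ π ∧ σ.1 + 1 = π.1}

/-- `s n`: the number of simple permutations of size `n`. -/
noncomputable def s (n : ℕ) : ℕ := {π : Equiv.Perm (Fin n) | IsSimple π}.ncard

/-- The number of simple permutations of size `n` that have exactly `k` children. -/
noncomputable def S (n k : ℕ) : ℕ :=
  {π : Equiv.Perm (Fin n) | IsSimple π ∧ (children ⟨n, π⟩).ncard = k}.ncard

/-- The number of simple permutations of size `n` whose outdegree in `G₁` is `k`. -/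
noncomputable def SG₁ (n k : ℕ) : ℕ :=
  {π : Vertex | π.1.1 = n ∧ outdegree G₁ π = k}.ncard

end SimplePermPoset

/-! Two estimates carry the proof: simple permutations are a positive proportion of all
permutations, and only O(n!) pairs (π, i), with π simple of size n, have a non-simple deletion at
position i. A simple π with at most k children gives at least n - k such pairs, because distinct
deletions of a simple permutation are distinct patterns (`del_injective`). Hence there are O(n!/(n -
k)) such π, which is o(s n).

Positive proportion (`factorial_le_mul_s`): proper intervals of length at least 3 occur in only O((n
- 1)!) permutations, by a union bound. Intervals of length 2 are bonds. Their mean number is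
bounded, so a positive proportion of permutations has at most 9, and a double count of swaps lowers
9 to 0 at the cost of a constant factor.

Deletions (`mem_near_of_not_isSimple_del`): if deleting an entry of a simple π creates an interval,
then π or its inverse maps a window minus one point onto a window. `card_near_le` counts these
configurations by the same union bound.

For G₁, each size has at most four exceptional permutations, so the outdegree is at least the number
of children minus 4. -/

namespace SimplePermPoset

open Finset

/-! ### Counting permutations that carry one set onto another -/

/-- The permutations that map `A` onto `B`. -/
def mapsOnto {n : ℕ} (A B : Finset (Fin n)) : Finset (Equiv.Perm (Fin n)) :=
  univ.filter fun π => A.image π = B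

/-- Such a permutation splits into a bijection from A to B and one between the complements. -/
theorem card_mapsOnto_le {n : ℕ} (A B : Finset (Fin n)) :
    #(mapsOnto A B) ≤ (#A).factorial * (n - #A).factorial := by
  classical
  have hmem : ∀ π : mapsOnto A B, ∀ a, a ∈ A ↔ π.1 a ∈ B := by
    rintro ⟨π, hπ⟩ a
    simp only [mapsOnto, mem_filter, mem_univ, true_and] at hπ
    simp [← hπ]
  let Φ : mapsOnto A B → (A ≃ B) × ({a // a ∉ A} ≃ {b // b ∉ B}) := fun π =>
    (π.1.subtypeEquiv (hmem π), π.1.subtypeEquiv fun a => not_congr (hmem π a))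
  have hΦ : Function.Injective Φ := by
    intro π ρ h
    apply Subtype.ext
    ext1 a
    by_cases ha : a ∈ A
    · exact congrArg Subtype.val (DFunLike.congr_fun (congrArg Prod.fst h) ⟨a, ha⟩)
    · exact congrArg Subtype.val (DFunLike.congr_fun (congrArg Prod.snd h) ⟨a, ha⟩)
  rcases (mapsOnto A B).eq_empty_or_nonempty with h0 | ⟨π, hπ⟩
  · simp [h0]
  · have h := Fintype.card_le_of_injective Φ hΦ
    rw [Fintype.card_prod, Fintype.card_equiv (Φ ⟨π, hπ⟩).1, Fintype.card_equiv (Φ ⟨π, hπ⟩).2,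
      Fintype.card_coe, Fintype.card_coe, Fintype.card_subtype_compl, Fintype.card_coe,
      Fintype.card_fin] at h
    exact h

theorem factorial_add_mul_factorial_add_le (k x y : ℕ) :
    (k + x).factorial * (k + y).factorial ≤ k.factorial * (k + x + y).factorial := by
  induction y with
  | zero => simp [mul_comm]
  | succ y ih =>
    rw [← add_assoc, ← add_assoc, Nat.factorial_succ, Nat.factorial_succ]
    calc (k + x).factorial * ((k + y + 1) * (k + y).factorial)
        = (k + y + 1) * ((k + x).factorial * (k + y).factorial) := by ring
      _ ≤ (k + x + y + 1) * (k.factorial * (k + x + y).factorial) :=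
          Nat.mul_le_mul (by omega) ih
      _ = _ := by ring

/-- Log-convexity of the factorial: on the range from k to M - k the product is largest at the ends.
-/
theorem factorial_mul_factorial_sub_le {k w M : ℕ} (h₁ : k ≤ w) (h₂ : w + k ≤ M) :
    w.factorial * (M - w).factorial ≤ k.factorial * (M - k).factorial := by
  obtain ⟨x, rfl⟩ := Nat.exists_eq_add_of_le h₁
  obtain ⟨y, rfl⟩ := Nat.exists_eq_add_of_le h₂
  have h := factorial_add_mul_factorial_add_le k x y
  rwa [show k + x + k + y - (k + x) = k + y by omega,
    show k + x + k + y - k = k + x + y by omega]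

/-! ### Windows and long intervals -/

/-- The window of `l` consecutive elements that starts at `a`. -/
def win (n a l : ℕ) : Finset (Fin n) := univ.filter fun x => a ≤ (x : ℕ) ∧ (x : ℕ) < a + l

theorem mem_win {n a l : ℕ} {x : Fin n} : x ∈ win n a l ↔ a ≤ (x : ℕ) ∧ (x : ℕ) < a + l := by
  simp [win]

theorem card_win {n a l : ℕ} (h : a + l ≤ n) : #(win n a l) = l := by
  have : (win n a l).map Fin.valEmbedding = Ico a (a + l) := by
    ext x
    simp only [Finset.mem_map, mem_win, Fin.valEmbedding_apply, mem_Ico]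
    exact ⟨by rintro ⟨y, hy, rfl⟩; exact hy, fun hx => ⟨⟨x, by omega⟩, hx, rfl⟩⟩
  rw [← card_map, this, Nat.card_Ico]; omega

theorem Icc_eq_win {n : ℕ} {i j : Fin n} :
    Finset.Icc i j = win n i ((j : ℕ) + 1 - i) := by
  ext x
  simp only [mem_win, mem_Icc, Fin.le_def]
  omega

theorem exists_eq_win_of_ordConnected {n : ℕ} {A : Finset (Fin n)} (hA : A.Nonempty)
    (h : (A : Set (Fin n)).OrdConnected) : ∃ c, c + #A ≤ n ∧ A = win n c #A := by
  have hw : A = Finset.Icc (A.min' hA) (A.max' hA) := by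
    ext x
    rw [mem_Icc]
    exact ⟨fun hx => ⟨A.min'_le x hx, A.le_max' x hx⟩,
      fun hx => h.out (A.min'_mem hA) (A.max'_mem hA) hx⟩
  have hle : (A.min' hA : ℕ) ≤ A.max' hA := Fin.le_def.1 (A.min'_le _ (A.max'_mem hA))
  have hc : #A = (A.max' hA : ℕ) + 1 - A.min' hA := by
    conv_lhs => rw [hw, Fin.card_Icc]
  have hlt := (A.max' hA).2
  refine ⟨A.min' hA, by omega, ?_⟩
  rw [hc, ← Icc_eq_win]
  exact hw

theorem ordConnected_win (n a l : ℕ) : (win n a l : Set (Fin n)).OrdConnected := by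
  constructor
  intro x hx y hy z hz
  simp only [mem_coe, mem_win, Set.mem_Icc, Fin.le_def] at *
  omega

/-- The permutations that map some window of length between `3` and `n - 1` onto a window. -/
def longInterval (n : ℕ) : Finset (Equiv.Perm (Fin n)) :=
  (Ico 3 n).biUnion fun l => (range (n - l + 1)).biUnion fun a =>
    (range (n - l + 1)).biUnion fun c => mapsOnto (win n a l) (win n c l)

/-- The two end terms are kept exactly and every other term is bounded by its value at w = 4. The
term w = n - 1 stands apart because w + 4 ≤ M may fail there. -/
theorem sum_factorial_mul_factorial_le {M n : ℕ} (h3 : 4 ≤ n) (hM : n + 2 ≤ M) :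
    ∑ w ∈ Ico 3 n, w.factorial * (M - w).factorial ≤
      6 * (M - 3).factorial + (n - 4) * (24 * (M - 4).factorial) +
        (n - 1).factorial * (M + 1 - n).factorial := by
  obtain ⟨m, rfl⟩ := Nat.exists_eq_add_of_le' h3
  rcases m with _ | m
  · simp
  · have h1 : ∑ w ∈ Ico 4 (m + 4), w.factorial * (M - w).factorial ≤
        (m + 4 - 4) * (24 * (M - 4).factorial) := by
      have := sum_le_card_nsmul (Ico 4 (m + 4)) (fun w => w.factorial * (M - w).factorial)
        (24 * (M - 4).factorial) (fun w hw => by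
          rw [mem_Ico] at hw
          exact factorial_mul_factorial_sub_le (k := 4) hw.1 (by omega))
      simpa using this
    rw [show m + 1 + 4 = m + 4 + 1 by ring, sum_Ico_succ_top (by omega),
      sum_eq_sum_Ico_succ_bot (by omega)]
    have e1 : M - (m + 4) = M + 1 - (m + 4 + 1) := by omega
    have e2 : m + 4 - 4 ≤ m + 4 + 1 - 4 := by omega
    have := Nat.mul_le_mul_right (24 * (M - 4).factorial) e2
    rw [e1, show Nat.factorial 3 = 6 from rfl, show m + 4 + 1 - 1 = m + 4 from rfl,
      show 3 + 1 = 4 from rfl]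
    omega

theorem card_longInterval_le {n : ℕ} (hn : 4 ≤ n) :
    #(longInterval n) ≤ 60 * (n - 1).factorial := by
  have h1 : #(longInterval n) ≤ ∑ l ∈ Ico 3 n, l.factorial * (n + 2 - l).factorial := by
    refine card_biUnion_le.trans (sum_le_sum fun l hl => ?_)
    rw [mem_Ico] at hl
    have key : ∀ a ∈ range (n - l + 1), ∀ c ∈ range (n - l + 1),
        #(mapsOnto (win n a l) (win n c l)) ≤ l.factorial * (n - l).factorial := by
      intro a ha c _
      rw [mem_range] at ha
      have := card_mapsOnto_le (win n a l) (win n c l)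
      rwa [card_win (by omega)] at this
    have h2 := card_biUnion_le_card_mul (range (n - l + 1)) (fun a =>
      (range (n - l + 1)).biUnion fun c => mapsOnto (win n a l) (win n c l)) _ fun a ha =>
        card_biUnion_le_card_mul _ _ _ (key a ha)
    rw [card_range] at h2
    refine h2.trans ?_
    -- The (n - l + 1)² choices of the two windows are absorbed by raising (n - l)! to (n + 2 - l)!.
    rw [show n + 2 - l = n - l + 1 + 1 by omega, Nat.factorial_succ, Nat.factorial_succ]
    calc (n - l + 1) * ((n - l + 1) * (l.factorial * (n - l).factorial))
        = l.factorial * ((n - l + 1) * ((n - l + 1) * (n - l).factorial)) := by ring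
      _ ≤ _ := Nat.mul_le_mul_left _ (Nat.mul_le_mul_right _ (by omega))
  refine h1.trans ((sum_factorial_mul_factorial_le hn (le_refl _)).trans ?_)
  obtain ⟨m, rfl⟩ := Nat.exists_eq_add_of_le' hn
  simp only [show m + 4 + 2 - 3 = m + 3 by omega, show m + 4 + 2 - 4 = m + 2 by omega,
    show m + 4 - 1 = m + 3 by omega, show m + 4 + 2 + 1 - (m + 4) = 3 by omega,
    show m + 4 - 4 = m by omega, Nat.factorial_succ (m + 2), Nat.factorial]
  nlinarith [Nat.zero_le (m.factorial * m), Nat.zero_le (m.factorial * m ^ 2),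
    Nat.zero_le (m.factorial * m ^ 3), Nat.zero_le m.factorial]

/-! ### Bonds and their removal by swaps -/

/-- Two elements of `Fin n` that differ by one. -/
abbrev Neighbor {n : ℕ} (x y : Fin n) : Prop := (x : ℕ) + 1 = y ∨ (y : ℕ) + 1 = x

/-- The neighbors of `x`. -/
def nb {n : ℕ} (x : Fin n) : Finset (Fin n) := univ.filter fun y => Neighbor x y

theorem mem_nb {n : ℕ} {x y : Fin n} : y ∈ nb x ↔ Neighbor x y := by simp [nb]

theorem card_nb_le {n : ℕ} (x : Fin n) : #(nb x) ≤ 2 := by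
  have h : (nb x).map Fin.valEmbedding ⊆ {(x : ℕ) + 1, (x : ℕ) - 1} := by
    intro y hy
    obtain ⟨z, hz, rfl⟩ := Finset.mem_map.1 hy
    rw [mem_nb] at hz
    simp only [Fin.valEmbedding_apply, mem_insert, mem_singleton]
    omega
  rw [← card_map Fin.valEmbedding]
  exact (card_le_card h).trans card_le_two

/-- The pairs of adjacent positions with adjacent values. -/
def bonds {n : ℕ} (π : Equiv.Perm (Fin n)) : Finset (Fin n × Fin n) :=
  univ.filter fun p => Neighbor p.1 p.2 ∧ Neighbor (π p.1) (π p.2)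

theorem mem_bonds {n : ℕ} {π : Equiv.Perm (Fin n)} {p q : Fin n} :
    (p, q) ∈ bonds π ↔ Neighbor p q ∧ Neighbor (π p) (π q) := by simp [bonds]

/-- The permutations with at most `j` bonds. -/
def fewBonds (n j : ℕ) : Finset (Equiv.Perm (Fin n)) := univ.filter fun π => #(bonds π) ≤ j

theorem mem_fewBonds {n j : ℕ} {π : Equiv.Perm (Fin n)} :
    π ∈ fewBonds n j ↔ #(bonds π) ≤ j := by simp [fewBonds]

theorem card_filter_neighbor_le {n : ℕ} {p q : Fin n} (h : p ≠ q) :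
    #((univ : Finset (Equiv.Perm (Fin n))).filter fun π => Neighbor (π p) (π q)) ≤
      n * (2 * (2 * (n - 2).factorial)) := by
  have hsub : ((univ : Finset (Equiv.Perm (Fin n))).filter fun π => Neighbor (π p) (π q)) ⊆
      univ.biUnion fun u => (nb u).biUnion fun v => mapsOnto {p, q} {u, v} := by
    intro π hπ
    rw [mem_filter] at hπ
    simp only [mem_biUnion, mem_univ, true_and]
    exact ⟨π p, π q, mem_nb.2 hπ.2, by simp [mapsOnto, image_insert]⟩
  refine (card_le_card hsub).trans ?_
  have := card_biUnion_le_card_mul univ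
    (fun u : Fin n => (nb u).biUnion fun v => mapsOnto {p, q} {u, v})
    (2 * (2 * (n - 2).factorial)) fun u _ => by
      refine (card_biUnion_le_card_mul _ _ (2 * (n - 2).factorial) fun v _ => ?_).trans
        (Nat.mul_le_mul_right _ (card_nb_le u))
      have := card_mapsOnto_le {p, q} {u, v}
      rwa [card_pair h] at this
  simpa using this

theorem sum_card_bonds_le (n : ℕ) :
    ∑ π : Equiv.Perm (Fin n), #(bonds π) ≤ 8 * (n * n * (n - 2).factorial) := by
  have h1 : ∀ π : Equiv.Perm (Fin n), #(bonds π) =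
      #(((univ : Finset (Fin n × Fin n)).filter fun p => Neighbor p.1 p.2).bipartiteAbove
        (fun (π : Equiv.Perm (Fin n)) p => Neighbor (π p.1) (π p.2)) π) := by
    intro π
    rw [bipartiteAbove, filter_filter]; rfl
  have h2 : #((univ : Finset (Fin n × Fin n)).filter fun p => Neighbor p.1 p.2) ≤ n * 2 := by
    have hs : ((univ : Finset (Fin n × Fin n)).filter fun p => Neighbor p.1 p.2) ⊆
        univ.biUnion fun x => (nb x).image fun y => (x, y) := by
      rintro ⟨x, y⟩ h
      simpa [nb] using h
    refine (card_le_card hs).trans ?_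
    simpa using card_biUnion_le_card_mul univ (fun x : Fin n => (nb x).image fun y => (x, y)) 2
      fun x _ => card_image_le.trans (card_nb_le x)
  simp only [h1]
  rw [sum_card_bipartiteAbove_eq_sum_card_bipartiteBelow]
  refine (sum_le_card_nsmul _ _ (n * (2 * (2 * (n - 2).factorial))) fun p hp => ?_).trans ?_
  · refine card_filter_neighbor_le ?_
    rintro h
    have := (mem_filter.1 hp).2
    rw [h] at this
    omega
  · rw [smul_eq_mul]
    refine (Nat.mul_le_mul_right _ h2).trans (le_of_eq ?_)
    ring

/-- Markov's inequality: the mean number of bonds, counted as ordered pairs, is at most 8n/(n - 1) ≤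
9. -/
theorem factorial_le_ten_mul_card_fewBonds {n : ℕ} (hn : 9 ≤ n) :
    n.factorial ≤ 10 * #(fewBonds n 9) := by
  have h1 : #((univ : Finset (Equiv.Perm (Fin n))).filter fun π => ¬ #(bonds π) ≤ 9) * 10 ≤
      9 * n.factorial := by
    calc _ = ∑ π ∈ (univ : Finset (Equiv.Perm (Fin n))).filter fun π => ¬ #(bonds π) ≤ 9, 10 := by
          rw [sum_const, smul_eq_mul]
      _ ≤ ∑ π ∈ (univ : Finset (Equiv.Perm (Fin n))).filter fun π => ¬ #(bonds π) ≤ 9,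
            #(bonds π) := sum_le_sum fun π hπ => by
              have := (mem_filter.1 hπ).2
              omega
      _ ≤ ∑ π : Equiv.Perm (Fin n), #(bonds π) :=
          sum_le_sum_of_subset_of_nonneg (filter_subset _ _) fun _ _ _ => Nat.zero_le _
      _ ≤ 8 * (n * n * (n - 2).factorial) := sum_card_bonds_le n
      _ ≤ 9 * n.factorial := by
          obtain ⟨m, rfl⟩ := Nat.exists_eq_add_of_le' hn
          rw [show m + 9 - 2 = m + 7 by omega, Nat.factorial_succ (m + 8),
            Nat.factorial_succ (m + 7)]
          calc 8 * ((m + 9) * (m + 9) * (m + 7).factorial)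
              = (8 * (m + 9)) * ((m + 9) * (m + 7).factorial) := by ring
            _ ≤ (9 * (m + 8)) * ((m + 9) * (m + 7).factorial) :=
                Nat.mul_le_mul_right _ (by omega)
            _ = _ := by ring
  have h2 := card_filter_add_card_filter_not (s := (univ : Finset (Equiv.Perm (Fin n))))
    fun π => #(bonds π) ≤ 9
  rw [card_univ, Fintype.card_perm, Fintype.card_fin] at h2
  change #(fewBonds n 9) + _ = _ at h2
  omega

/-- The positions `r` such that exchanging the values at `p` and `r` may create bonds. -/
def badSwaps {n : ℕ} (π : Equiv.Perm (Fin n)) (p : Fin n) : Finset (Fin n) :=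
  ({p} ∪ nb p) ∪ (((nb p).biUnion fun x => (nb (π x)).image π.symm) ∪
    (nb (π p)).biUnion fun y => nb (π.symm y))

theorem card_badSwaps_le {n : ℕ} (π : Equiv.Perm (Fin n)) (p : Fin n) :
    #(badSwaps π p) ≤ 11 := by
  have h1 : #({p} ∪ nb p) ≤ 1 + 2 :=
    (card_union_le _ _).trans (Nat.add_le_add (by simp) (card_nb_le p))
  have h2 : #((nb p).biUnion fun x => (nb (π x)).image π.symm) ≤ 2 * 2 :=
    (card_biUnion_le_card_mul _ _ 2 fun x _ => card_image_le.trans (card_nb_le _)).trans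
      (Nat.mul_le_mul_right _ (card_nb_le p))
  have h3 : #((nb (π p)).biUnion fun y => nb (π.symm y)) ≤ 2 * 2 :=
    (card_biUnion_le_card_mul _ _ 2 fun x _ => card_nb_le _).trans
      (Nat.mul_le_mul_right _ (card_nb_le _))
  exact (card_union_le _ _).trans
    ((Nat.add_le_add h1 ((card_union_le _ _).trans (Nat.add_le_add h2 h3))).trans (by norm_num))

theorem not_mem_badSwaps {n : ℕ} {π : Equiv.Perm (Fin n)} {p r : Fin n}
    (h : r ∉ badSwaps π p) : r ≠ p ∧ ¬ Neighbor p r ∧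
      (∀ x, Neighbor p x → ¬ Neighbor (π x) (π r)) ∧
      (∀ x, Neighbor x r → ¬ Neighbor (π p) (π x)) := by
  simp only [badSwaps, mem_union, mem_singleton, mem_biUnion, mem_image, mem_nb, not_or,
    not_exists, not_and] at h
  refine ⟨h.1.1, not_or.2 h.1.2, fun x hx hr => h.2.1 x hx (π r) hr (by simp), fun x hx hr => ?_⟩
  have h' := h.2.2 (π x) hr
  rw [Equiv.symm_apply_apply] at h'
  exact hx.elim h'.1 h'.2

/-- Outside `badSwaps` neither moved value meets a neighboring value at its new place, so no bond is
created, and every bond at p is lost. -/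
theorem bonds_swap_subset {n : ℕ} {π : Equiv.Perm (Fin n)} {p r : Fin n}
    (h : r ∉ badSwaps π p) :
    bonds ((Equiv.swap p r).trans π) ⊆ (bonds π).filter fun x => x.1 ≠ p ∧ x.2 ≠ p := by
  obtain ⟨h1, h2, h3, h4⟩ := not_mem_badSwaps h
  have h2' : ¬ Neighbor r p := fun h => h2 h.symm
  rintro ⟨x, y⟩ hxy
  rw [mem_bonds] at hxy
  obtain ⟨ha, hb⟩ := hxy
  simp only [Equiv.trans_apply] at hb
  have hxy : x ≠ y := by rintro rfl; omega
  rw [mem_filter, mem_bonds]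
  by_cases hx : x = p
  · subst hx
    have hy : y ≠ r := by rintro rfl; exact h2 ha
    rw [Equiv.swap_apply_left, Equiv.swap_apply_of_ne_of_ne hxy.symm hy] at hb
    exact absurd hb.symm (h3 y ha)
  by_cases hy : y = p
  · subst hy
    have hx' : x ≠ r := by rintro rfl; exact h2' ha
    rw [Equiv.swap_apply_left, Equiv.swap_apply_of_ne_of_ne hx hx'] at hb
    exact absurd hb (h3 x ha.symm)
  by_cases hxr : x = r
  · subst hxr
    rw [Equiv.swap_apply_right, Equiv.swap_apply_of_ne_of_ne hy hxy.symm] at hb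
    exact absurd hb (h4 y ha.symm)
  by_cases hyr : y = r
  · subst hyr
    rw [Equiv.swap_apply_right, Equiv.swap_apply_of_ne_of_ne hx hxr] at hb
    exact absurd hb.symm (h4 x ha)
  rw [Equiv.swap_apply_of_ne_of_ne hx hxr, Equiv.swap_apply_of_ne_of_ne hy hyr] at hb
  exact ⟨⟨ha, hb⟩, hx, hy⟩

/-- `ρ` arises from `π` by a swap that destroys a bond and creates none. -/
def SwapsTo {n : ℕ} (π ρ : Equiv.Perm (Fin n)) : Prop :=
  ∃ p q r, (p, q) ∈ bonds π ∧ r ∉ badSwaps π p ∧ ρ = (Equiv.swap p r).trans π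

-- Double count of `SwapsTo`: each π with j + 1 bonds has at least n - 11 images and each ρ at most
-- 4n preimages. For n ≥ 22 the ratio is at most 8; permutations with at most j bonds add 1.
open Classical in
theorem card_fewBonds_succ_le {n : ℕ} (hn : 22 ≤ n) (j : ℕ) :
    #(fewBonds n (j + 1)) ≤ 9 * #(fewBonds n j) := by
  have hab : ∀ π ∈ (univ : Finset (Equiv.Perm (Fin n))).filter fun π => #(bonds π) = j + 1,
      n - 11 ≤ #((fewBonds n j).bipartiteAbove SwapsTo π) := by
    intro π hπ
    replace hπ := (mem_filter.1 hπ).2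
    obtain ⟨⟨p, q⟩, hpq⟩ : (bonds π).Nonempty := card_pos.1 (by omega)
    have hsub : ((badSwaps π p)ᶜ).image (fun r => (Equiv.swap p r).trans π) ⊆
        (fewBonds n j).bipartiteAbove SwapsTo π := by
      intro ρ hρ
      obtain ⟨r, hr, rfl⟩ := mem_image.1 hρ
      rw [mem_compl] at hr
      refine (mem_bipartiteAbove _).2 ⟨mem_fewBonds.2 ?_, p, q, r, hpq, hr, rfl⟩
      have hlt : #(bonds ((Equiv.swap p r).trans π)) < #(bonds π) := by
        refine card_lt_card (lt_of_le_of_lt (bonds_swap_subset hr) ?_)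
        refine (filter_ssubset).2 ⟨(p, q), hpq, by simp⟩
      omega
    refine le_trans ?_ (card_le_card hsub)
    rw [card_image_of_injective, card_compl, Fintype.card_fin]
    · have := card_badSwaps_le π p
      omega
    · intro r r' h
      have h' : π (Equiv.swap p r p) = π (Equiv.swap p r' p) := DFunLike.congr_fun h p
      simpa using h'
  have hbe : ∀ ρ ∈ fewBonds n j,
      #(((univ : Finset (Equiv.Perm (Fin n))).filter fun π => #(bonds π) = j + 1).bipartiteBelow
        SwapsTo ρ) ≤ n * 4 := by
    intro ρ _
    -- To recover π from ρ, choose r. The old partner q of p has not moved, so π q is one of two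
    -- neighbors of ρ r, and p is one of two neighbors of q.
    have hsub : ((univ : Finset (Equiv.Perm (Fin n))).filter
        fun π => #(bonds π) = j + 1).bipartiteBelow SwapsTo ρ ⊆
        univ.biUnion fun r => (nb (ρ r)).biUnion fun y => (nb (ρ.symm y)).image fun p =>
          (Equiv.swap p r).trans ρ := by
      intro π hπ
      obtain ⟨p, q, r, hpq, hr, rfl⟩ := ((mem_bipartiteBelow _).1 hπ).2
      obtain ⟨h1, h2, -, -⟩ := not_mem_badSwaps hr
      rw [mem_bonds] at hpq
      have hqp : q ≠ p := by rintro rfl; omega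
      have hqr : q ≠ r := by rintro rfl; exact h2 hpq.1
      simp only [mem_biUnion, mem_univ, true_and, mem_image, mem_nb]
      refine ⟨r, π q, by simpa using hpq.2, p, ?_, ?_⟩
      · have : ((Equiv.swap p r).trans π).symm (π q) = q := by
          rw [Equiv.symm_apply_eq, Equiv.trans_apply, Equiv.swap_apply_of_ne_of_ne hqp hqr]
        rw [this]
        exact hpq.1.symm
      · ext1 x
        simp
    refine (card_le_card hsub).trans ?_
    simpa using card_biUnion_le_card_mul univ (fun r : Fin n => (nb (ρ r)).biUnion fun y =>
      (nb (ρ.symm y)).image fun p => (Equiv.swap p r).trans ρ) 4 fun r _ =>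
        (card_biUnion_le_card_mul _ _ 2 fun y _ => card_image_le.trans (card_nb_le _)).trans
          (Nat.mul_le_mul_right 2 (card_nb_le _))
  have key := card_mul_le_card_mul SwapsTo hab hbe
  have hle : #(fewBonds n (j + 1)) ≤ #(fewBonds n j) +
      #((univ : Finset (Equiv.Perm (Fin n))).filter fun π => #(bonds π) = j + 1) := by
    refine (card_le_card fun π hπ => ?_).trans (card_union_le _ _)
    rw [mem_fewBonds] at hπ
    simp only [mem_union, mem_fewBonds, mem_filter, mem_univ, true_and]
    omega
  have h8 : #((univ : Finset (Equiv.Perm (Fin n))).filter fun π => #(bonds π) = j + 1) ≤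
      8 * #(fewBonds n j) := by
    obtain ⟨m, rfl⟩ := Nat.exists_eq_add_of_le' hn
    rw [show m + 22 - 11 = m + 11 by omega] at key
    by_contra! hlt
    nlinarith
  omega

theorem factorial_le_mul_card_fewBonds_zero {n : ℕ} (hn : 22 ≤ n) :
    n.factorial ≤ 10 * 9 ^ 9 * #(fewBonds n 0) := by
  have h : ∀ j, #(fewBonds n j) ≤ 9 ^ j * #(fewBonds n 0) := by
    intro j
    induction j with
    | zero => simp
    | succ j ih =>
      calc _ ≤ 9 * #(fewBonds n j) := card_fewBonds_succ_le hn j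
        _ ≤ 9 * (9 ^ j * #(fewBonds n 0)) := Nat.mul_le_mul_left _ ih
        _ = _ := by ring
  have h9 := h 9
  have h10 := factorial_le_ten_mul_card_fewBonds (n := n) (by omega)
  omega

/-! ### Simple permutations have positive proportion -/

/-- The simple permutations of size `n`. -/
noncomputable def simples (n : ℕ) : Finset (Equiv.Perm (Fin n)) :=
  open Classical in univ.filter fun π => IsSimple π

theorem mem_simples {n : ℕ} {π : Equiv.Perm (Fin n)} : π ∈ simples n ↔ IsSimple π := by
  simp [simples]

theorem s_eq_card_simples (n : ℕ) : s n = #(simples n) := by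
  rw [s, ← Set.ncard_coe_finset]
  congr 1
  ext π
  simp [mem_simples]

theorem exists_mapsOnto_win_of_not_isSimple {n : ℕ} {π : Equiv.Perm (Fin n)}
    (h : ¬ IsSimple π) : ∃ l a c, 2 ≤ l ∧ l < n ∧ a + l ≤ n ∧ c + l ≤ n ∧
      (win n a l).image π = win n c l := by
  simp only [IsSimple, not_forall, not_or] at h
  obtain ⟨i, j, hij, hord, hne, huniv⟩ := h
  have hcard : #((Finset.Icc i j).image π) = (j : ℕ) + 1 - i := by
    rw [card_image_of_injective _ π.injective, Fin.card_Icc]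
  obtain ⟨c, hc, hw⟩ := exists_eq_win_of_ordConnected (A := (Finset.Icc i j).image π)
    ⟨π i, mem_image_of_mem _ (mem_Icc.2 ⟨le_refl _, hij⟩)⟩ (by simpa using hord)
  rw [hcard] at hc hw
  rw [Icc_eq_win] at hw
  have hlt : i < j := lt_of_le_of_ne hij hne
  rw [Fin.lt_def] at hlt
  refine ⟨(j : ℕ) + 1 - i, i, c, by omega, ?_, by omega, hc, hw⟩
  by_contra hge
  apply huniv
  ext x
  simp only [Set.mem_Icc, Set.mem_univ, Fin.le_def, iff_true]
  omega

theorem image_win_ne_of_isSimple {n : ℕ} {π : Equiv.Perm (Fin n)} (h : IsSimple π)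
    {l a c : ℕ} (h2 : 2 ≤ l) (hln : l < n) (ha : a + l ≤ n) :
    (win n a l).image π ≠ win n c l := by
  intro him
  have hI : (⟨a, by omega⟩ : Fin n) ≤ ⟨a + l - 1, by omega⟩ := by
    rw [Fin.le_def]; simp only; omega
  have hw : win n a l = Finset.Icc (⟨a, by omega⟩ : Fin n) ⟨a + l - 1, by omega⟩ := by
    rw [Icc_eq_win]; congr 1; simp only; omega
  have hs : (Set.Icc (⟨a, by omega⟩ : Fin n) ⟨a + l - 1, by omega⟩) = (win n a l : Set (Fin n)) := by
    rw [hw, coe_Icc]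
  have hord := ordConnected_win n c l
  rw [← him, coe_image, ← hs] at hord
  rcases h _ _ hI hord with h' | h'
  · simp only [Fin.mk.injEq] at h'; omega
  · rw [hs, ← coe_univ, coe_inj] at h'
    have hc := card_win ha
    rw [h', card_univ, Fintype.card_fin] at hc
    omega

theorem factorial_le_mul_s {n : ℕ} (hn : 240 * 9 ^ 9 * 10 ≤ n) :
    n.factorial ≤ 20 * 9 ^ 9 * s n := by
  have h0 := factorial_le_mul_card_fewBonds_zero (n := n) (by omega)
  have hsub : fewBonds n 0 ⊆ simples n ∪ longInterval n := by
    intro π hπ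
    by_contra hnot
    simp only [mem_union, mem_simples, not_or] at hnot
    obtain ⟨l, a, c, h2, hln, ha, hc, him⟩ := exists_mapsOnto_win_of_not_isSimple hnot.1
    rcases h2.eq_or_lt with rfl | h3
    · rw [mem_fewBonds, Nat.le_zero, card_eq_zero] at hπ
      have hp : (⟨a, by omega⟩ : Fin n) ∈ win n a 2 := by simp [mem_win]
      have hq : (⟨a + 1, by omega⟩ : Fin n) ∈ win n a 2 := by simp [mem_win]
      have hp' := mem_image_of_mem π hp
      have hq' := mem_image_of_mem π hq
      have hne : π ⟨a, by omega⟩ ≠ π ⟨a + 1, by omega⟩ := by simp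
      rw [Ne, Fin.ext_iff] at hne
      rw [him, mem_win] at hp' hq'
      have : ((⟨a, by omega⟩, ⟨a + 1, by omega⟩) : Fin n × Fin n) ∈ bonds π := by
        rw [mem_bonds]
        exact ⟨Or.inl rfl, by unfold Neighbor; omega⟩
      simp [hπ] at this
    · apply hnot.2
      simp only [longInterval, mem_biUnion, mem_Ico, mem_range]
      exact ⟨l, ⟨h3, hln⟩, a, by omega, c, by omega, by simpa [mapsOnto] using him⟩
  have h1 := (card_le_card hsub).trans (card_union_le _ _)
  have h2 := card_longInterval_le (n := n) (by omega)
  rw [← s_eq_card_simples] at h1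
  have h3 : n.factorial = n * (n - 1).factorial := by
    obtain ⟨m, rfl⟩ := Nat.exists_eq_add_of_le' (show 1 ≤ n by omega)
    simp [Nat.factorial_succ]
  -- The threshold on n makes the loss 10 · 9⁹ · 60 · (n - 1)! at most n!/4.
  have h4 := Nat.mul_le_mul_right (n - 1).factorial hn
  rw [← h3] at h4
  omega

/-! ### Deleting one entry -/

theorem exists_succAbove_apply {n : ℕ} (π : Equiv.Perm (Fin (n + 1))) (i : Fin (n + 1)) :
    ∃ σ : Equiv.Perm (Fin n), ∀ p, (π i).succAbove (σ p) = π (i.succAbove p) := by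
  have h : ∀ p, ∃ q, (π i).succAbove q = π (i.succAbove p) := fun p =>
    Fin.exists_succAbove_eq fun h => Fin.succAbove_ne i p (π.injective h)
  choose f hf using h
  have hinj : Function.Injective f := fun p q hpq => by
    have := hf p
    rw [hpq, hf q] at this
    exact (Fin.succAbove_right_injective (π.injective this)).symm
  exact ⟨Equiv.ofBijective f (Finite.injective_iff_bijective.1 hinj), hf⟩

/-- The pattern of `π` that is left when the entry at position `i` is deleted. -/
noncomputable def del {n : ℕ} (π : Equiv.Perm (Fin (n + 1))) (i : Fin (n + 1)) :
    Equiv.Perm (Fin n) := (exists_succAbove_apply π i).choose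

theorem succAbove_del {n : ℕ} (π : Equiv.Perm (Fin (n + 1))) (i : Fin (n + 1)) (p : Fin n) :
    (π i).succAbove (del π i p) = π (i.succAbove p) := (exists_succAbove_apply π i).choose_spec p

theorem isPattern_del {n : ℕ} (π : Equiv.Perm (Fin (n + 1))) (i : Fin (n + 1)) :
    IsPattern ⟨n, del π i⟩ ⟨n + 1, π⟩ := by
  refine ⟨i.succAbove, Fin.strictMono_succAbove i, fun a b => ?_⟩
  simp only
  rw [← succAbove_del, ← succAbove_del]
  exact ((Fin.strictMono_succAbove (π i)).lt_iff_lt).symm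

theorem val_succAbove {n : ℕ} (i : Fin (n + 1)) (p : Fin n) :
    (i.succAbove p : ℕ) = if (p : ℕ) < i then (p : ℕ) else p + 1 := by
  split_ifs with h
  · rw [Fin.succAbove_of_castSucc_lt _ _ (by simpa [Fin.lt_def] using h)]; rfl
  · rw [Fin.succAbove_of_le_castSucc _ _ (by simpa [Fin.le_def] using h)]; rfl

/-- If the deletions at i < j agree, their common value q at position i comes from π (i + 1) in one
and from π i in the other. Both lie in {q, q + 1}, so positions i and i + 1 form an interval. -/
theorem del_ne_of_lt {n : ℕ} {π : Equiv.Perm (Fin (n + 1))} (hn : 2 ≤ n) (hπ : IsSimple π)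
    {i j : Fin (n + 1)} (hij : i < j) : del π i ≠ del π j := by
  intro h
  rw [Fin.lt_def] at hij
  let p : Fin n := ⟨i, by omega⟩
  let i' : Fin (n + 1) := ⟨i + 1, by omega⟩
  have h1 : i.succAbove p = i' := by ext; rw [val_succAbove]; simp [p, i']
  have h2 : j.succAbove p = i := by ext; rw [val_succAbove]; simp [p, hij]
  have e1 := congrArg Fin.val (succAbove_del π i p)
  have e2 := congrArg Fin.val (succAbove_del π j p)
  rw [val_succAbove, h1, h] at e1
  rw [val_succAbove, h2] at e2
  have hne : (π i : ℕ) ≠ π i' := by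
    rw [Ne, ← Fin.ext_iff, π.injective.eq_iff, Fin.ext_iff]
    simp [i']
  have hwin : win (n + 1) i 2 = {i, i'} := by
    ext x
    simp only [mem_win, mem_insert, mem_singleton, Fin.ext_iff, i']
    omega
  refine image_win_ne_of_isSimple hπ (l := 2) (a := i) (c := del π j p) (le_refl _) (by omega)
    (by omega) ?_
  rw [hwin]
  ext x
  simp only [mem_win, image_insert, image_singleton, mem_insert, mem_singleton, Fin.ext_iff]
  split_ifs at e1 e2 <;> omega

theorem del_injective {n : ℕ} {π : Equiv.Perm (Fin (n + 1))} (hn : 2 ≤ n) (hπ : IsSimple π) :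
    Function.Injective (del π) := by
  intro i j h
  by_contra hne
  rcases lt_or_gt_of_ne hne with hlt | hlt
  · exact del_ne_of_lt hn hπ hlt h
  · exact del_ne_of_lt hn hπ hlt h.symm

/-- Reinserting the point i leaves a window whole, unless i falls strictly inside it and opens a
hole. -/
theorem image_succAbove_win {n : ℕ} (i : Fin (n + 1)) {a l : ℕ} (h : a + l ≤ n) :
    (∃ a', a' + l ≤ n + 1 ∧ (win n a l).image i.succAbove = win (n + 1) a' l) ∨
      (i ∈ win (n + 1) a (l + 1) ∧
        (win n a l).image i.succAbove = (win (n + 1) a (l + 1)).erase i) := by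
  have hmem : ∀ x, x ∈ (win n a l).image i.succAbove ↔ x ≠ i ∧
      (((x : ℕ) < i ∧ a ≤ (x : ℕ) ∧ (x : ℕ) < a + l) ∨
        ((i : ℕ) < x ∧ a < (x : ℕ) ∧ (x : ℕ) ≤ a + l)) := by
    intro x
    rw [mem_image]
    constructor
    · rintro ⟨p, hp, rfl⟩
      refine ⟨Fin.succAbove_ne i p, ?_⟩
      rw [mem_win] at hp
      rw [val_succAbove]
      split_ifs <;> omega
    · rintro ⟨hne, hx⟩
      obtain ⟨p, rfl⟩ := Fin.exists_succAbove_eq hne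
      refine ⟨p, ?_, rfl⟩
      rw [val_succAbove] at hx
      rw [mem_win]
      split_ifs at hx <;> omega
  rcases le_or_gt (i : ℕ) a with h1 | h1
  · refine Or.inl ⟨a + 1, by omega, ?_⟩
    ext x
    rw [hmem, mem_win, Ne, Fin.ext_iff]
    omega
  rcases le_or_gt (a + l) (i : ℕ) with h2 | h2
  · refine Or.inl ⟨a, by omega, ?_⟩
    ext x
    rw [hmem, mem_win, Ne, Fin.ext_iff]
    omega
  · refine Or.inr ⟨by rw [mem_win]; omega, ?_⟩
    ext x
    rw [hmem, mem_erase, mem_win, Ne, Fin.ext_iff]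
    omega

/-- The pairs `(π, i)` such that `π` maps some window with its element `i` removed onto a window. -/
def near (n : ℕ) : Finset (Equiv.Perm (Fin n) × Fin n) :=
  (Ico 3 n).biUnion fun w => (range (n - w + 1)).biUnion fun a =>
    (range (n - w + 2)).biUnion fun c => (win n a w).biUnion fun i =>
      (mapsOnto ((win n a w).erase i) (win n c (w - 1))).image fun π => (π, i)

theorem card_near_le {n : ℕ} (hn : 4 ≤ n) : #(near n) ≤ 30 * n.factorial := by
  have h1 : #(near n) ≤ ∑ w ∈ Ico 3 n, w.factorial * (n + 3 - w).factorial := by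
    refine card_biUnion_le.trans (sum_le_sum fun w hw => ?_)
    rw [mem_Ico] at hw
    refine (card_biUnion_le_card_mul _ _ ((n - w + 2) * (w * ((w - 1).factorial *
      (n - (w - 1)).factorial))) fun a ha => ?_).trans ?_
    · rw [mem_range] at ha
      have hc := card_win (n := n) (a := a) (l := w) (by omega)
      refine (card_biUnion_le_card_mul _ _ (w * ((w - 1).factorial *
        (n - (w - 1)).factorial)) fun c _ => ?_).trans (le_of_eq (by rw [card_range]))
      refine (card_biUnion_le_card_mul _ _ ((w - 1).factorial *
        (n - (w - 1)).factorial) fun i hi => ?_).trans (le_of_eq (by rw [hc]))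
      have := card_mapsOnto_le ((win n a w).erase i) (win n c (w - 1))
      rw [card_erase_of_mem hi, hc] at this
      exact card_image_le.trans this
    · obtain ⟨v, rfl⟩ := Nat.exists_eq_add_of_le' (show 1 ≤ w by omega)
      rw [card_range, Nat.add_sub_cancel, show n - v = n - (v + 1) + 1 by omega,
        show n + 3 - (v + 1) = n - (v + 1) + 1 + 1 + 1 by omega, Nat.factorial_succ v,
        Nat.factorial_succ (n - (v + 1) + 1 + 1), Nat.factorial_succ (n - (v + 1) + 1)]
      generalize n - (v + 1) = t
      calc (t + 1) * ((t + 2) * ((v + 1) * (v.factorial * (t + 1).factorial)))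
          = (v + 1) * v.factorial * ((t + 1) * ((t + 2) * (t + 1).factorial)) := by ring
        _ ≤ _ := Nat.mul_le_mul_left _ (Nat.mul_le_mul_right _ (by omega))
  refine h1.trans ((sum_factorial_mul_factorial_le hn (by omega)).trans ?_)
  obtain ⟨m, rfl⟩ := Nat.exists_eq_add_of_le' hn
  simp only [show m + 4 + 3 - 3 = m + 4 by omega, show m + 4 + 3 - 4 = m + 3 by omega,
    show m + 4 - 1 = m + 3 by omega, show m + 4 + 3 + 1 - (m + 4) = 4 by omega,
    show m + 4 - 4 = m by omega, Nat.factorial_succ (m + 3), show Nat.factorial 4 = 24 from rfl]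
  nlinarith [Nat.zero_le (m * (m + 3).factorial), Nat.zero_le (m + 3).factorial]

theorem mem_near_of_image_eq {n : ℕ} {π : Equiv.Perm (Fin n)} {i : Fin n} {a c l : ℕ}
    (h2 : 2 ≤ l) (hl : l + 1 < n) (ha : a + l + 1 ≤ n) (hc : c + l ≤ n)
    (hi : i ∈ win n a (l + 1)) (h : ((win n a (l + 1)).erase i).image π = win n c l) :
    (π, i) ∈ near n := by
  simp only [near, mem_biUnion, mem_Ico, mem_range]
  refine ⟨l + 1, by omega, a, by omega, c, by omega, i, hi, mem_image_of_mem _ ?_⟩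
  simpa [mapsOnto] using h

/-- Lift the new interval back to π. With no hole, or with holes in both positions and values
(filled by the deleted entry), π would have a proper interval. A single hole gives a near pair, for
π if it is in the positions and for the inverse if it is in the values. -/
theorem mem_near_of_not_isSimple_del {n : ℕ} {π : Equiv.Perm (Fin (n + 1))} (hπ : IsSimple π)
    {i : Fin (n + 1)} (h : ¬ IsSimple (del π i)) :
    (π, i) ∈ near (n + 1) ∨ (π⁻¹, π i) ∈ near (n + 1) := by
  obtain ⟨l, a, c, h2, hln, ha, hc, him⟩ := exists_mapsOnto_win_of_not_isSimple h
  have key : ((win n a l).image i.succAbove).image π =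
      (win n c l).image (π i).succAbove := by
    rw [← him, image_image, image_image]
    exact image_congr fun p _ => (succAbove_del π i p).symm
  rcases image_succAbove_win i ha with ⟨a', ha', hA⟩ | ⟨hi, hA⟩ <;>
  rcases image_succAbove_win (π i) hc with ⟨c', hc', hC⟩ | ⟨hi', hC⟩ <;>
  rw [hA, hC] at key
  · exact absurd key (image_win_ne_of_isSimple hπ h2 (by omega) ha')
  · right
    refine mem_near_of_image_eq h2 (by omega) (by omega) ha' hi' ?_
    rw [← key, image_image]
    ext x; simp
  · exact Or.inl (mem_near_of_image_eq h2 (by omega) (by omega) hc' hi key)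
  · refine absurd ?_ (image_win_ne_of_isSimple hπ (l := l + 1) (a := a) (c := c) (by omega)
      (by omega) (by omega))
    rw [← insert_erase hi, image_insert, key, insert_erase hi']

theorem finite_children (π : SPerm) : (children π).Finite := by
  obtain ⟨_ | n, π⟩ := π
  · refine Set.Finite.subset Set.finite_empty ?_
    rintro σ ⟨-, -, h⟩
    simp at h
  · refine Set.Finite.subset (Set.finite_range fun σ : Equiv.Perm (Fin n) => (⟨n, σ⟩ : SPerm)) ?_
    rintro ⟨m, σ⟩ ⟨-, -, h⟩
    simp only [Nat.add_right_cancel_iff] at h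
    subst h
    exact ⟨σ, rfl⟩

/-! ### Simple permutations with few children -/

open Classical in
theorem card_filter_isSimple_del_le {n : ℕ} {π : Equiv.Perm (Fin (n + 1))} (hn : 2 ≤ n)
    (hπ : IsSimple π) :
    #((univ : Finset (Fin (n + 1))).filter fun i => IsSimple (del π i)) ≤
      (children ⟨n + 1, π⟩).ncard := by
  rw [← Set.ncard_coe_finset]
  refine Set.ncard_le_ncard_of_injOn (fun i => (⟨n, del π i⟩ : SPerm)) ?_ ?_ (finite_children _)
  · intro i hi
    rw [coe_filter] at hi
    exact ⟨hi.2, isPattern_del π i, rfl⟩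
  · intro i _ j _ h
    exact del_injective hn hπ (by simpa using h)

/-- The simple permutations of size `n` with at most `k` children. -/
noncomputable def fewChildren (n k : ℕ) : Finset (Equiv.Perm (Fin n)) :=
  (simples n).filter fun π => (children ⟨n, π⟩).ncard ≤ k

open Classical in
theorem card_fewChildren_mul_le {n : ℕ} (hn : 3 ≤ n) (k : ℕ) :
    #(fewChildren (n + 1) k) * (n + 1 - k) ≤ 60 * (n + 1).factorial := by
  -- The map (ρ, j) ↦ (ρ⁻¹, ρ j) turns (π⁻¹, π i) back into (π, i), so the two cases together cost 2
  -- · 30 · (n + 1)!.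
  let bad : Finset (Equiv.Perm (Fin (n + 1)) × Fin (n + 1)) :=
    near (n + 1) ∪ (near (n + 1)).image fun x => (x.1⁻¹, x.1 x.2)
  have hbad : #bad ≤ 60 * (n + 1).factorial := by
    have h1 := card_near_le (n := n + 1) (by omega)
    have h2 : #((near (n + 1)).image fun x => (x.1⁻¹, x.1 x.2)) ≤ _ := card_image_le
    have h3 : #bad ≤ _ := card_union_le _ _
    omega
  refine le_trans ?_ hbad
  rw [← smul_eq_mul]
  calc #(fewChildren (n + 1) k) • (n + 1 - k)
      ≤ ∑ π ∈ fewChildren (n + 1) k,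
          #((univ : Finset (Fin (n + 1))).filter fun i => ¬ IsSimple (del π i)) := by
        refine card_nsmul_le_sum _ _ _ fun π hπ => ?_
        obtain ⟨hs, hk⟩ := mem_filter.1 hπ
        have h1 := card_filter_isSimple_del_le (by omega) (mem_simples.1 hs)
        have h2 := card_filter_add_card_filter_not (s := (univ : Finset (Fin (n + 1))))
          fun i => IsSimple (del π i)
        rw [card_univ, Fintype.card_fin] at h2
        omega
    _ = #((fewChildren (n + 1) k).sigma fun π =>
          (univ : Finset (Fin (n + 1))).filter fun i => ¬ IsSimple (del π i)) :=
        (card_sigma _ _).symm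
    _ ≤ #bad := by
        refine card_le_card_of_injOn (fun x => (x.1, x.2)) ?_ ?_
        · rintro ⟨π, i⟩ hx
          rw [mem_coe, mem_sigma, mem_filter] at hx
          have hs := mem_simples.1 (mem_filter.1 hx.1).1
          rcases mem_near_of_not_isSimple_del hs hx.2.2 with h | h
          · exact mem_coe.2 (mem_union_left _ h)
          · refine mem_coe.2 (mem_union_right _ (mem_image.2 ⟨_, h, ?_⟩))
            simp
        · rintro ⟨π, i⟩ _ ⟨ρ, j⟩ _ h
          simpa using h

theorem tendsto_fewChildren (k : ℕ) :
    Tendsto (fun n : ℕ => (#(fewChildren n k) : ℝ) / (s n : ℝ)) atTop (𝓝 0) := by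
  have hlim : Tendsto (fun n : ℕ => (1200 * 9 ^ 9 : ℝ) / ((n : ℝ) - k)) atTop (𝓝 0) := by
    refine Tendsto.div_atTop tendsto_const_nhds ?_
    simpa [sub_eq_add_neg] using
      tendsto_atTop_add_const_right atTop (-(k : ℝ)) tendsto_natCast_atTop_atTop
  refine squeeze_zero' (Eventually.of_forall fun n => by positivity) ?_ hlim
  filter_upwards [eventually_ge_atTop (240 * 9 ^ 9 * 10 + (k + 1))] with n hn
  have h1 := factorial_le_mul_s (n := n) (by omega)
  obtain ⟨m, rfl⟩ := Nat.exists_eq_add_of_le' (show 1 ≤ n by omega)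
  have h2 := card_fewChildren_mul_le (n := m) (by omega) k
  have hs : 0 < s (m + 1) := by
    have := Nat.factorial_pos (m + 1)
    by_contra h0
    rw [Nat.eq_zero_of_not_pos h0] at h1
    omega
  have h3 : #(fewChildren (m + 1) k) * (m + 1 - k) ≤ 1200 * 9 ^ 9 * s (m + 1) := by
    refine h2.trans ((Nat.mul_le_mul_left 60 h1).trans (le_of_eq ?_))
    ring
  have hk : k < m + 1 := by omega
  have h4 : (#(fewChildren (m + 1) k) : ℝ) * (((m + 1 : ℕ) : ℝ) - k) ≤
      1200 * 9 ^ 9 * s (m + 1) := by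
    rw [← Nat.cast_sub hk.le]
    exact_mod_cast h3
  rw [div_le_div_iff₀ (by exact_mod_cast hs) (sub_pos.2 (by exact_mod_cast hk))]
  exact h4

/-! ### Exceptional permutations and the outdegree in G₁ -/

theorem eq_id_of_strictMono {n : ℕ} {f : Fin n → Fin n} (hf : StrictMono f) : f = id := by
  have hs := Finite.surjective_of_injective hf.injective
  exact (hf.range_inj strictMono_id).1 (by rw [hs.range_eq, Set.range_id])

theorem IsPattern.size_le {π σ : SPerm} (h : IsPattern π σ) : π.1 ≤ σ.1 := by
  obtain ⟨f, hf, -⟩ := h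
  simpa using Fintype.card_le_of_injective f hf.injective

theorem IsPattern.eq_of_size_eq {π σ : SPerm} (h : IsPattern π σ) (hs : π.1 = σ.1) : π = σ := by
  obtain ⟨n, π⟩ := π
  obtain ⟨m, σ⟩ := σ
  simp only at hs
  subst hs
  obtain ⟨f, hf, hlt⟩ := h
  rw [eq_id_of_strictMono hf] at hlt
  have hmono : StrictMono fun x => σ (π.symm x) := by
    intro x y hxy
    have := hlt (π.symm x) (π.symm y)
    simp only [Equiv.apply_symm_apply, id] at this
    exact this.1 hxy
  congr 1
  ext1 a
  have := congrFun (eq_id_of_strictMono hmono) (π a)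
  simpa using this.symm

theorem IsStrictPattern.size_lt {π σ : SPerm} (h : IsStrictPattern π σ) : π.1 < σ.1 :=
  lt_of_le_of_ne h.1.size_le fun hs => h.2 (h.1.eq_of_size_eq hs)

theorem finite_setOf_size_le (n : ℕ) : {σ : SPerm | σ.1 ≤ n}.Finite := by
  refine Set.Finite.subset (Set.finite_range fun x : Σ m : Fin (n + 1), Equiv.Perm (Fin m) =>
    (⟨x.1, x.2⟩ : SPerm)) ?_
  rintro ⟨m, σ⟩ h
  exact ⟨⟨⟨m, Nat.lt_succ_of_le h⟩, σ⟩, rfl⟩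

theorem word_injective : Function.Injective word := by
  rintro ⟨n, σ⟩ ⟨m, τ⟩ h
  have hl := congrArg List.length h
  simp only [word, List.length_ofFn] at hl
  subst hl
  have hf := List.ofFn_injective h
  congr 1
  ext1 i
  have := congrFun hf i
  simp only [Nat.add_right_cancel_iff] at this
  exact Fin.ext this

/-- The size forces m = n / 2, which leaves four possible words. -/
theorem ncard_isExceptional_le (n : ℕ) :
    {σ : SPerm | IsExceptional σ ∧ σ.1 = n}.Finite ∧
      {σ : SPerm | IsExceptional σ ∧ σ.1 = n}.ncard ≤ 4 := by
  let W : Finset (List ℕ) := {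
    ((List.range (n / 2)).map fun i => 2 * i + 2) ++ ((List.range (n / 2)).map fun i => 2 * i + 1),
    ((List.range (n / 2)).map fun i => 2 * (n / 2) - 1 - 2 * i) ++
      ((List.range (n / 2)).map fun i => 2 * (n / 2) - 2 * i),
    (List.range (n / 2)).flatMap (fun i => [n / 2 + 1 + i, i + 1]),
    (List.range (n / 2)).flatMap (fun i => [n / 2 - i, 2 * (n / 2) - i])}
  have hW : ∀ σ ∈ {σ : SPerm | IsExceptional σ ∧ σ.1 = n}, word σ ∈ (W : Set (List ℕ)) := by
    rintro σ ⟨⟨m, -, hm⟩, hn⟩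
    have hlen : (word σ).length = n := by rw [word, List.length_ofFn, hn]
    have hmn : m = n / 2 := by
      rcases hm with h | h | h | h <;> rw [h] at hlen <;>
        simp [List.length_flatMap] at hlen <;> omega
    subst hmn
    simpa [W] using hm
  constructor
  · exact Set.Finite.of_finite_image (W.finite_toSet.subset (Set.image_subset_iff.2 hW))
      word_injective.injOn
  · refine (Set.ncard_le_ncard_of_injOn word hW word_injective.injOn W.finite_toSet).trans ?_
    rw [Set.ncard_coe_finset]
    exact card_le_four

theorem adj_of_mem_children {v w : Vertex} (h : w.1 ∈ children v.1) : G.Adj v w := by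
  obtain ⟨-, hp, hs⟩ := h
  refine ⟨⟨hp, fun h => by rw [h] at hs; omega⟩, ?_⟩
  rintro ⟨τ, h1, h2⟩
  have := h1.size_lt
  have := h2.size_lt
  omega

/-- Every child is a neighbor in G, since no size lies strictly between, and only exceptional
children can lose their edge. Size at least 5 makes the children vertices. -/
theorem ncard_children_le_outdegree {v : Vertex} (hv : 5 ≤ v.1.1) :
    (children v.1).ncard ≤ outdegree G₁ v + 4 := by
  have hsub : children v.1 ⊆ Subtype.val '' {w : Vertex | G₁.Adj v w} ∪
      {σ : SPerm | IsExceptional σ ∧ σ.1 = v.1.1 - 1} := by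
    intro σ hσ
    by_cases he : IsExceptional σ
    · exact Or.inr ⟨he, by have := hσ.2.2; omega⟩
    · refine Or.inl ⟨⟨σ, by have := hσ.2.2; omega, hσ.1⟩, ⟨adj_of_mem_children hσ, ?_⟩, rfl⟩
      exact fun h => he h.2
  have hfin : (Subtype.val '' {w : Vertex | G₁.Adj v w}).Finite := by
    refine (finite_setOf_size_le v.1.1).subset ?_
    rintro _ ⟨w, hw, rfl⟩
    exact hw.1.1.1.size_le
  obtain ⟨hE, hE4⟩ := ncard_isExceptional_le (v.1.1 - 1)
  refine (Set.ncard_le_ncard hsub (hfin.union hE)).trans ((Set.ncard_union_le _ _).trans ?_)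
  rw [Set.ncard_image_of_injective _ Subtype.val_injective]
  exact Nat.add_le_add_left hE4 _

theorem S_le_card_fewChildren (n k : ℕ) : S n k ≤ #(fewChildren n k) := by
  rw [S, ← Set.ncard_coe_finset]
  refine Set.ncard_le_ncard ?_ (finite_toSet _)
  rintro π ⟨hs, hk⟩
  exact mem_coe.2 (mem_filter.2 ⟨mem_simples.2 hs, hk.le⟩)

theorem SG₁_le_card_fewChildren {n : ℕ} (hn : 5 ≤ n) (k : ℕ) :
    SG₁ n k ≤ #(fewChildren n (k + 4)) := by
  classical
  refine le_trans ?_ (card_image_le (s := fewChildren n (k + 4))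
    (f := fun π => (⟨n, π⟩ : SPerm)))
  rw [SG₁, ← Set.ncard_coe_finset]
  refine Set.ncard_le_ncard_of_injOn Subtype.val ?_ Subtype.val_injective.injOn (finite_toSet _)
  rintro ⟨⟨m, π⟩, h4, hs⟩ ⟨hm, hk⟩
  simp only at hm
  subst hm
  refine mem_coe.2 (mem_image_of_mem _ (mem_filter.2 ⟨mem_simples.2 hs, ?_⟩))
  have h := ncard_children_le_outdegree (v := ⟨⟨m, π⟩, h4, hs⟩) hn
  rwa [hk] at h

end SimplePermPoset

theorem mainTheorem8 (k : ℕ) :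
    Tendsto (fun n : ℕ => (SimplePermPoset.S n k : ℝ) / (SimplePermPoset.s n : ℝ)) atTop (𝓝 0) ∧
    Tendsto (fun n : ℕ => (SimplePermPoset.SG₁ n k : ℝ) / (SimplePermPoset.s n : ℝ)) atTop
      (𝓝 0) := by
  constructor
  · refine squeeze_zero (fun n => by positivity) (fun n => ?_)
      (SimplePermPoset.tendsto_fewChildren k)
    gcongr
    exact SimplePermPoset.S_le_card_fewChildren n k
  · refine squeeze_zero' (Eventually.of_forall fun n => by positivity) ?_
      (SimplePermPoset.tendsto_fewChildren (k + 4))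
    filter_upwards [eventually_ge_atTop 5] with n hn
    gcongr
    exact SimplePermPoset.SG₁_le_card_fewChildren hn k
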